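/- Let $N\ge 3$ and $2^*=\frac{2N}{N-2}$. Let $H^1(\mathbb{R}^N)$ be the space of real-valued $u\in L^2(\mathbb{R}^N)$ whose weak gradient $\nabla u$ exists and belongs to $L^2(\mathbb{R}^N;\mathbb{R}^N)$, and let $$X=\Big\{u\in H^1(\mathbb{R}^N)\,:\,\int_{\mathbb{R}^N}\big[|\nabla u|^2+|x|^2u^2\big]\,dx<\infty\Big\},$$ equipped with the scalar product $\langle u,w\rangle_X=\int_{\mathbb{R}^N}\big[\nabla u\cdot\nabla w+|x|^2uw\big]\,dx$ and the associated norm $\|u\|_X=\Big(\int_{\mathbb{R}^N}\big[|\nabla u|^2+|x|^2u^2\big]\,dx\Big)^{1/2}$. Then, for every $q\in[2,2^*]$, every $u\in X$ belongs to $L^q(\mathbb{R}^N)$ and the embedding $X\hookrightarrow L^q(\mathbb{R}^N)$ is a continuous linear map; moreover, for every $q\in[2,2^*)$ this embedding is compact. -/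

import Mathlib

open MeasureTheory
open scoped ENNReal ContDiff

noncomputable section

namespace HarmonicOscillator

/-- The Euclidean space `ℝ^N`. -/
abbrev Space (N : ℕ) : Type := EuclideanSpace ℝ (Fin N)

/-- `g` is the weak (distributional) gradient of `u` on `ℝ^N`:
`∫ u ∂_v φ = - ∫ φ ⟨g, v⟩` for all test functions `φ ∈ C_c^∞(ℝ^N)` and all directions `v`.
It is only used for `u`, `g` of class `L²`, for which both integrands are integrable. -/
def IsWeakGradient {N : ℕ} (u : Space N → ℝ) (g : Space N → Space N) : Prop :=
  ∀ φ : Space N → ℝ, ContDiff ℝ ∞ φ → HasCompactSupport φ → ∀ v : Space N,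
    ∫ x, u x * fderiv ℝ φ x v = - ∫ x, φ x * inner ℝ (g x) v

/-- A test function is in every `L^p`. -/
lemma memLp_test {N : ℕ} {φ : Space N → ℝ} (h : ContDiff ℝ ∞ φ) (hc : HasCompactSupport φ)
    (p : ℝ≥0∞) : MemLp φ p volume :=
  h.continuous.memLp_of_hasCompactSupport hc

/-- A directional derivative of a test function is in every `L^p`. -/
lemma memLp_fderiv_test {N : ℕ} {φ : Space N → ℝ} (h : ContDiff ℝ ∞ φ)
    (hc : HasCompactSupport φ) (v : Space N) (p : ℝ≥0∞) :
    MemLp (fun x => fderiv ℝ φ x v) p volume := by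
  refine Continuous.memLp_of_hasCompactSupport ?_ ?_
  · exact (h.continuous_fderiv (by simp)).clm_apply continuous_const
  · exact hc.fderiv_apply (𝕜 := ℝ) v

lemma integrable_mul_fderiv {N : ℕ} {φ : Space N → ℝ} (h : ContDiff ℝ ∞ φ)
    (hc : HasCompactSupport φ) (v : Space N) {u : Space N → ℝ} (hu : MemLp u 2 volume) :
    Integrable (fun x => u x * fderiv ℝ φ x v) :=
  hu.integrable_mul (memLp_fderiv_test h hc v 2)

lemma integrable_mul_inner {N : ℕ} {φ : Space N → ℝ} (h : ContDiff ℝ ∞ φ)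
    (hc : HasCompactSupport φ) (v : Space N) {g : Space N → Space N} (hg : MemLp g 2 volume) :
    Integrable (fun x => φ x * inner ℝ (g x) v) :=
  (memLp_test h hc 2).integrable_mul (hg.inner_const v)

lemma IsWeakGradient.congr {N : ℕ} {u u' : Space N → ℝ} {g g' : Space N → Space N}
    (h : IsWeakGradient u g) (hu : u =ᵐ[volume] u') (hg : g =ᵐ[volume] g') :
    IsWeakGradient u' g' := by
  intro φ hφ hc v
  have h1 : ∫ x, u' x * fderiv ℝ φ x v = ∫ x, u x * fderiv ℝ φ x v :=
    integral_congr_ae (by filter_upwards [hu] with x hx using by rw [hx])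
  have h2 : ∫ x, φ x * inner ℝ (g' x) v = ∫ x, φ x * inner ℝ (g x) v :=
    integral_congr_ae (by filter_upwards [hg] with x hx using by rw [hx])
  rw [h1, h2, h φ hφ hc v]

lemma IsWeakGradient.add {N : ℕ} {u w : Space N → ℝ} {g k : Space N → Space N}
    (h : IsWeakGradient u g) (h' : IsWeakGradient w k)
    (hu : MemLp u 2 volume) (hw : MemLp w 2 volume)
    (hg : MemLp g 2 volume) (hk : MemLp k 2 volume) :
    IsWeakGradient (u + w) (g + k) := by
  intro φ hφ hc v
  simp only [Pi.add_apply, inner_add_left, add_mul, mul_add]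
  rw [integral_add (integrable_mul_fderiv hφ hc v hu) (integrable_mul_fderiv hφ hc v hw),
    integral_add (integrable_mul_inner hφ hc v hg) (integrable_mul_inner hφ hc v hk),
    h φ hφ hc v, h' φ hφ hc v]
  ring

lemma IsWeakGradient.const_smul {N : ℕ} {u : Space N → ℝ} {g : Space N → Space N}
    (h : IsWeakGradient u g) (c : ℝ) : IsWeakGradient (c • u) (c • g) := by
  intro φ hφ hc v
  simp only [Pi.smul_apply, smul_eq_mul, inner_smul_left, conj_trivial]
  have e1 : ∀ x, c * u x * fderiv ℝ φ x v = c * (u x * fderiv ℝ φ x v) := fun x => by ring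
  have e2 : ∀ x, φ x * (c * inner ℝ (g x) v) = c * (φ x * inner ℝ (g x) v) := fun x => by ring
  simp only [e1, e2]
  rw [integral_const_mul, integral_const_mul, h φ hφ hc v]
  ring

/-- The weak gradient is unique. -/
lemma IsWeakGradient.unique {N : ℕ} {u : Space N → ℝ}
    {g k : Lp (Space N) 2 (volume : Measure (Space N))} (h : IsWeakGradient u g) (h' : IsWeakGradient u k) : g = k := by
  have hg := Lp.memLp g
  have hk := Lp.memLp k
  have key : ∀ᵐ x ∂(volume : Measure (Space N)), (g - k : Space N → Space N) x = 0 := by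
    refine ae_eq_zero_of_integral_contDiff_smul_eq_zero ?_ ?_
    · exact (hg.sub hk).locallyIntegrable (by norm_num)
    · intro φ hφ hc
      have ig : Integrable (fun x => φ x • g x) :=
        memLp_one_iff_integrable.1 (hg.smul (memLp_test hφ hc 2))
      have ik : Integrable (fun x => φ x • k x) :=
        memLp_one_iff_integrable.1 (hk.smul (memLp_test hφ hc 2))
      refine ext_inner_right ℝ fun v => ?_
      have e : ∀ x, φ x • (g - k : Space N → Space N) x = φ x • g x - φ x • k x := fun x => by
        simp [smul_sub]
      simp only [e, inner_zero_left]
      rw [integral_sub ig ik, inner_sub_left, sub_eq_zero, real_inner_comm, real_inner_comm v,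
        ← integral_inner ig, ← integral_inner ik]
      have := (h φ hφ hc v).symm.trans (h' φ hφ hc v)
      rw [neg_inj] at this
      simpa only [inner_smul_right, real_inner_comm] using this
  refine Lp.ext ?_
  filter_upwards [key] with x hx
  exact sub_eq_zero.mp hx

/-- The Sobolev space `H¹(ℝ^N)`: the (classes of) functions `u ∈ L²(ℝ^N)` that have a weak gradient
in `L²(ℝ^N; ℝ^N)`. -/
def H1 (N : ℕ) : Submodule ℝ (Lp ℝ 2 (volume : Measure (Space N))) where
  carrier := {u | ∃ g : Lp (Space N) 2 (volume : Measure (Space N)), IsWeakGradient u g}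
  zero_mem' := by
    refine ⟨0, IsWeakGradient.congr (u := 0) (g := 0) ?_ (Lp.coeFn_zero _ _ _).symm
      (Lp.coeFn_zero _ _ _).symm⟩
    intro φ _ _ v
    simp
  add_mem' := by
    rintro u w ⟨g, hg⟩ ⟨k, hk⟩
    exact ⟨g + k, (hg.add hk (Lp.memLp u) (Lp.memLp w) (Lp.memLp g) (Lp.memLp k)).congr
      (Lp.coeFn_add _ _).symm (Lp.coeFn_add _ _).symm⟩
  smul_mem' := by
    rintro c u ⟨g, hg⟩
    exact ⟨c • g, (hg.const_smul c).congr (Lp.coeFn_smul _ _).symm (Lp.coeFn_smul _ _).symm⟩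

/-- The weak gradient `∇u ∈ L²(ℝ^N; ℝ^N)` of `u ∈ H¹(ℝ^N)`. -/
def weakGrad {N : ℕ} (u : H1 N) : Lp (Space N) 2 (volume : Measure (Space N)) :=
  Classical.choose u.2

lemma isWeakGradient_weakGrad {N : ℕ} (u : H1 N) :
    IsWeakGradient (u : Lp ℝ 2 (volume : Measure (Space N))) (weakGrad u) :=
  Classical.choose_spec u.2

lemma weakGrad_add {N : ℕ} (u w : H1 N) : weakGrad (u + w) = weakGrad u + weakGrad w :=
  (isWeakGradient_weakGrad (u + w)).unique
    (((isWeakGradient_weakGrad u).add (isWeakGradient_weakGrad w) (Lp.memLp _) (Lp.memLp _)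
      (Lp.memLp _) (Lp.memLp _)).congr (Lp.coeFn_add _ _).symm (Lp.coeFn_add _ _).symm)

lemma weakGrad_smul {N : ℕ} (c : ℝ) (u : H1 N) : weakGrad (c • u) = c • weakGrad u :=
  (isWeakGradient_weakGrad (c • u)).unique
    (((isWeakGradient_weakGrad u).const_smul c).congr
      (Lp.coeFn_smul _ _).symm (Lp.coeFn_smul _ _).symm)

/-- The density `|∇u|² + |x|² u²` of the energy of the harmonic oscillator. -/
def energyDensity {N : ℕ} (u : H1 N) (x : Space N) : ℝ :=
  ‖weakGrad u x‖ ^ 2 + ‖x‖ ^ 2 * (u.1 x) ^ 2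

lemma integrable_weakGrad_sq {N : ℕ} (u : H1 N) : Integrable (fun x => ‖weakGrad u x‖ ^ 2) :=
  (Lp.memLp (weakGrad u)).norm.integrable_sq

/-- `∫ (|∇u|² + |x|² u²) < ∞` if and only if `|x| u ∈ L²`. -/
lemma integrable_energyDensity_iff {N : ℕ} (u : H1 N) :
    Integrable (energyDensity u) ↔ MemLp (fun x : Space N => ‖x‖ * u.1 x) 2 volume := by
  have hm : AEStronglyMeasurable (fun x : Space N => ‖x‖ * u.1 x) volume :=
    continuous_norm.aestronglyMeasurable.mul (Lp.aestronglyMeasurable u.1)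
  rw [memLp_two_iff_integrable_sq hm]
  simp only [mul_pow]
  exact integrable_add_iff_integrable_right (integrable_weakGrad_sq u)

/-- The functions `u ∈ H¹(ℝ^N)` with `∫ (|∇u|² + |x|² u²) dx < ∞`, as a subspace of `H¹(ℝ^N)`. -/
def finiteEnergy (N : ℕ) : Submodule ℝ (H1 N) where
  carrier := {u | Integrable (energyDensity u)}
  zero_mem' := by
    change Integrable (energyDensity _)
    rw [integrable_energyDensity_iff]
    refine (MemLp.zero (p := 2) (ε := ℝ)).ae_eq ?_
    filter_upwards [Lp.coeFn_zero ℝ 2 (volume : Measure (Space N))] with x hx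
    rw [Submodule.coe_zero, hx, Pi.zero_apply, mul_zero]
  add_mem' := by
    intro u w hu hw
    change Integrable (energyDensity _) at *
    rw [integrable_energyDensity_iff] at *
    refine (hu.add hw).ae_eq ?_
    filter_upwards [Lp.coeFn_add u.1 w.1] with x hx
    simp only [Submodule.coe_add, hx, Pi.add_apply]
    ring
  smul_mem' := by
    intro c u hu
    change Integrable (energyDensity _) at *
    rw [integrable_energyDensity_iff] at *
    refine (hu.const_smul c).ae_eq ?_
    filter_upwards [Lp.coeFn_smul c u.1] with x hx
    simp only [Submodule.coe_smul, hx, Pi.smul_apply, smul_eq_mul]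
    ring

/-- The space `X` of the harmonic oscillator. It is a type of its own, so that it carries the energy
norm defined below and not the norm of `L²`. -/
def X (N : ℕ) : Type := finiteEnergy N

namespace X

instance (N : ℕ) : AddCommGroup (X N) := inferInstanceAs (AddCommGroup (finiteEnergy N))

instance (N : ℕ) : Module ℝ (X N) := inferInstanceAs (Module ℝ (finiteEnergy N))

variable {N : ℕ}

/-- The element of `H¹(ℝ^N)` underlying an element of `X`. -/
def toH1 : X N →ₗ[ℝ] H1 N := (finiteEnergy N).subtype

/-- The (class of) function(s) in `L²(ℝ^N)` underlying an element of `X`. -/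
def toLp : X N →ₗ[ℝ] Lp ℝ 2 (volume : Measure (Space N)) := (H1 N).subtype ∘ₗ toH1

lemma toLp_injective : Function.Injective (toLp (N := N)) :=
  Subtype.coe_injective.comp Subtype.coe_injective

lemma integrable_energyDensity (u : X N) : Integrable (energyDensity (toH1 u)) volume := u.2

lemma memLp_weight (u : X N) : MemLp (fun x : Space N => ‖x‖ * toLp u x) 2 volume :=
  (integrable_energyDensity_iff (toH1 u)).1 (integrable_energyDensity u)

/-- The scalar product `⟨u, w⟩ = ∫ (∇u · ∇w + |x|² u w) dx` of `X`. -/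
instance : Inner ℝ (X N) where
  inner u w := ∫ x : Space N,
    (inner ℝ (weakGrad (toH1 u) x) (weakGrad (toH1 w) x) + ‖x‖ ^ 2 * (toLp u x * toLp w x))

lemma inner_def (u w : X N) : inner ℝ u w = ∫ x : Space N,
    (inner ℝ (weakGrad (toH1 u) x) (weakGrad (toH1 w) x) + ‖x‖ ^ 2 * (toLp u x * toLp w x)) :=
  rfl

lemma integrable_inner (u w : X N) : Integrable (fun x : Space N =>
    (inner ℝ (weakGrad (toH1 u) x) (weakGrad (toH1 w) x)
      + ‖x‖ ^ 2 * (toLp u x * toLp w x))) := by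
  refine (L2.integrable_inner (𝕜 := ℝ) (weakGrad (toH1 u)) (weakGrad (toH1 w))).add ?_
  refine ((memLp_weight u).integrable_mul (memLp_weight w)).congr (ae_of_all _ fun x => ?_)
  simp only [Pi.mul_apply]
  ring

lemma inner_self_eq (u : X N) : inner ℝ u u = ∫ x, energyDensity (toH1 u) x := by
  rw [inner_def]
  refine integral_congr_ae (ae_of_all _ fun x => ?_)
  simp only [energyDensity, real_inner_self_eq_norm_sq, ← pow_two]
  rfl

lemma energyDensity_nonneg (u : H1 N) (x : Space N) : 0 ≤ energyDensity u x := by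
  unfold energyDensity
  positivity

/-- The scalar product of `X` is one (for `N ≥ 1`). -/
@[reducible]
def core (N : ℕ) [NeZero N] : InnerProductSpace.Core ℝ (X N) where
  conj_inner_symm u w := by
    simp only [inner_def, conj_trivial]
    refine integral_congr_ae (ae_of_all _ fun x => ?_)
    simp only [real_inner_comm, mul_comm (toLp u x)]
  re_inner_nonneg u := by
    rw [inner_self_eq]
    exact integral_nonneg (energyDensity_nonneg _)
  add_left u w z := by
    rw [inner_def, inner_def, inner_def, ← integral_add (integrable_inner u z)
      (integrable_inner w z)]
    refine integral_congr_ae ?_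
    rw [map_add, map_add, weakGrad_add]
    filter_upwards [Lp.coeFn_add (weakGrad (toH1 u)) (weakGrad (toH1 w)),
      Lp.coeFn_add (toLp u) (toLp w)] with x h1 h2
    rw [h1, h2]
    simp only [Pi.add_apply, inner_add_left]
    ring
  smul_left u w c := by
    rw [inner_def, inner_def, conj_trivial, ← integral_const_mul]
    refine integral_congr_ae ?_
    rw [map_smul, map_smul, weakGrad_smul]
    filter_upwards [Lp.coeFn_smul c (weakGrad (toH1 u)),
      Lp.coeFn_smul c (toLp u)] with x h1 h2
    rw [h1, h2]
    simp only [Pi.smul_apply, inner_smul_left, smul_eq_mul, conj_trivial]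
    ring
  definite u hu := by
    rw [inner_self_eq, integral_eq_zero_iff_of_nonneg (energyDensity_nonneg _)
      (integrable_energyDensity u)] at hu
    refine toLp_injective ?_
    rw [map_zero]
    refine Lp.ext ?_
    have h0 : ∀ᵐ x ∂(volume : Measure (Space N)), x ≠ 0 := by
      simp [ae_iff]
    filter_upwards [hu, h0, Lp.coeFn_zero ℝ 2 (volume : Measure (Space N))] with x h1 h2 h3
    rw [h3]
    have h4 : ‖weakGrad (toH1 u) x‖ ^ 2 + ‖x‖ ^ 2 * (toLp u x) ^ 2 = 0 := h1
    have h5 : ‖x‖ ^ 2 * (toLp u x) ^ 2 = 0 := by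
      have := sq_nonneg ‖weakGrad (toH1 u) x‖
      have : 0 ≤ ‖x‖ ^ 2 * (toLp u x) ^ 2 := by positivity
      linarith
    have h6 : ‖x‖ ^ 2 ≠ 0 := by simpa using h2
    simpa [h6] using h5

instance [NeZero N] : NormedAddCommGroup (X N) := (core N).toNormedAddCommGroup

instance [NeZero N] : InnerProductSpace ℝ (X N) := InnerProductSpace.ofCore (core N).toCore

/-- The norm of `X` is the energy norm `‖u‖² = ∫ (|∇u|² + |x|² u²) dx`. -/
lemma norm_sq_eq [NeZero N] (u : X N) : ‖u‖ ^ 2 = ∫ x, energyDensity (toH1 u) x := by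
  rw [← real_inner_self_eq_norm_sq]
  exact inner_self_eq u

end X

/-- The critical Sobolev exponent `2^* = 2N / (N - 2)`, for `N ≥ 3`. -/
def criticalExponent (N : ℕ) : ℝ≥0∞ := ENNReal.ofReal (2 * (N : ℝ) / ((N : ℝ) - 2))

end HarmonicOscillator

end

open Filter Topology Convolution
open scoped NNReal

namespace HarmonicOscillator

variable {N : ℕ}

/-! Mollification and cutoff approximate a function with an `L²` weak gradient almost everywhere by
test functions whose gradients are asymptotically no larger (`IsWeakGradient.exists_approx`).
Fatou's lemma then extends to it two inequalities for smooth functions: the Sobolev inequality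
`‖u‖_{2^*} ≤ K ‖∇u‖₂` and the translation estimate `‖u(· + z) - u‖₂ ≤ |z| ‖∇u‖₂`.

Continuity: the Sobolev inequality bounds the `L^{2^*}` norm by the energy norm. The energy contains
no `∫ u²`, but on the unit ball Hölder's inequality compares `L²` with `L^{2^*}`, and outside it
`|u| ≤ |x| |u|`. Exponents in between follow by interpolation.

Compactness in `L²`: replace `u` by its means over the cubes of side `1/n` covering the ball of
radius `n`, and by `0` elsewhere. This is a finite-rank operator. On the cubes the translation
estimate makes the error `O(1/n) ‖∇u‖₂`; off them `|x| ≥ n`, so the error is at most `‖|x| u‖₂ / n`.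
The embedding is thus a limit in operator norm of compact operators. For `2 ≤ q < 2^*` the
interpolation inequality has a positive power of the `L²` norm, which carries total boundedness from
`L²` to `L^q`. -/

/-! ### Cauchy–Schwarz, `L²` norms and Fatou -/

/-- Cauchy–Schwarz against the constant `1`; for a probability measure this is Jensen's inequality
for the square. -/
lemma sq_lintegral_le {α : Type*} [MeasurableSpace α] (ν : Measure α) {f : α → ℝ≥0∞}
    (hf : AEMeasurable f ν) : (∫⁻ a, f a ∂ν) ^ 2 ≤ ν Set.univ * ∫⁻ a, f a ^ 2 ∂ν := by
  have h := ENNReal.lintegral_mul_norm_pow_le (μ := ν) (f := fun _ => (1 : ℝ≥0∞))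
    (g := fun a => f a ^ 2) aemeasurable_const (hf.pow_const 2) (p := 1 / 2) (q := 1 / 2)
    (by norm_num) (by norm_num) (by norm_num)
  have e : ∀ y : ℝ≥0∞, (y ^ 2) ^ (1 / 2 : ℝ) = y := fun y => by
    rw [← ENNReal.rpow_natCast, ← ENNReal.rpow_mul]; norm_num
  have e' : ∀ y : ℝ≥0∞, (y ^ (1 / 2 : ℝ)) ^ 2 = y := fun y => by
    rw [← ENNReal.rpow_natCast, ← ENNReal.rpow_mul]; norm_num
  simp only [ENNReal.one_rpow, one_mul, e, lintegral_one] at h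
  exact (pow_le_pow_left₀ zero_le h 2).trans_eq (by rw [mul_pow, e', e'])

lemma eLpNorm_two_sq {α F : Type*} [MeasurableSpace α] [NormedAddCommGroup F] (μ : Measure α)
    (f : α → F) : eLpNorm f 2 μ ^ 2 = ∫⁻ x, ‖f x‖ₑ ^ 2 ∂μ := by
  rw [← ENNReal.rpow_natCast, eLpNorm_eq_lintegral_rpow_enorm_toReal (by norm_num) (by norm_num),
    ← ENNReal.rpow_mul]
  norm_num

lemma eLpNorm_two_le_iff {α β F G : Type*} [MeasurableSpace α] [MeasurableSpace β]
    [NormedAddCommGroup F] [NormedAddCommGroup G] {μ : Measure α} {ν : Measure β}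
    {f : α → F} {g : β → G} :
    eLpNorm f 2 μ ≤ eLpNorm g 2 ν ↔ ∫⁻ x, ‖f x‖ₑ ^ 2 ∂μ ≤ ∫⁻ x, ‖g x‖ₑ ^ 2 ∂ν := by
  rw [← eLpNorm_two_sq, ← eLpNorm_two_sq, (ENNReal.pow_right_strictMono two_ne_zero).le_iff_le]

/-- Fatou's lemma. Because only pointwise convergence is needed, inequalities pass from test
functions to Sobolev functions without convergence in norm. -/
lemma eLpNorm_le_of_ae_tendsto {α F : Type*} [MeasurableSpace α] [NormedAddCommGroup F]
    {μ : Measure α} {p : ℝ≥0∞} {f : ℕ → α → F} {f' : α → F} {c : ℕ → ℝ≥0∞} {c' : ℝ≥0∞}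
    (hf : ∀ n, AEStronglyMeasurable (f n) μ)
    (hlim : ∀ᵐ x ∂μ, Tendsto (fun n => f n x) atTop (𝓝 (f' x)))
    (hc : ∀ n, eLpNorm (f n) p μ ≤ c n) (hc' : Tendsto c atTop (𝓝 c')) :
    eLpNorm f' p μ ≤ c' := by
  rw [← hc'.liminf_eq]
  exact (Lp.eLpNorm_lim_le_liminf_eLpNorm hf f' hlim).trans
    (liminf_le_liminf (Eventually.of_forall hc))

/-! ### Approximation by test functions -/

/-- Convolution with a probability density does not increase the `L²` norm. -/
lemma eLpNorm_two_convolution_le {F : Type*} [NormedAddCommGroup F] [NormedSpace ℝ F]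
    {φ : Space N → ℝ} (hφ : Continuous φ) (hφ0 : ∀ x, 0 ≤ φ x) (hφi : Integrable φ)
    (hφ1 : ∫ x, φ x = 1) {g : Space N → F} (hg : AEStronglyMeasurable g) :
    eLpNorm (φ ⋆[ContinuousLinearMap.lsmul ℝ ℝ] g) 2 volume ≤ eLpNorm g 2 volume := by
  rw [eLpNorm_two_le_iff]
  -- With the density absorbed into a probability measure, the convolution is a mean of translates
  -- of `g`: Jensen, Tonelli and translation invariance finish.
  let ν : Measure (Space N) := volume.withDensity fun x => ENNReal.ofReal (φ x)
  have hφm : Measurable fun x => ENNReal.ofReal (φ x) := hφ.measurable.ennreal_ofReal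
  have hν : ν Set.univ = 1 := by
    rw [withDensity_apply _ MeasurableSet.univ, Measure.restrict_univ,
      ← ofReal_integral_eq_lintegral_ofReal hφi (ae_of_all _ hφ0), hφ1, ENNReal.ofReal_one]
  have hprob : IsProbabilityMeasure ν := ⟨hν⟩
  have hac : ν ≪ volume := withDensity_absolutelyContinuous _ _
  have hsub : Measure.QuasiMeasurePreserving (fun p : Space N × Space N => p.1 - p.2)
      (volume.prod ν) volume :=
    (quasiMeasurePreserving_sub volume volume).mono_left
      (Measure.AbsolutelyContinuous.rfl.prod hac)
  have hm : AEMeasurable (fun p : Space N × Space N => ‖g (p.1 - p.2)‖ₑ) (volume.prod ν) :=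
    (hg.comp_quasiMeasurePreserving hsub).enorm
  have hmx : ∀ x, AEMeasurable (fun t => ‖g (x - t)‖ₑ) ν := fun x =>
    ((hg.comp_quasiMeasurePreserving
      (quasiMeasurePreserving_sub_left volume x)).mono_ac hac).enorm
  have hle : ∀ x, ‖(φ ⋆[ContinuousLinearMap.lsmul ℝ ℝ] g) x‖ₑ ≤ ∫⁻ t, ‖g (x - t)‖ₑ ∂ν := by
    intro x
    rw [lintegral_withDensity_eq_lintegral_mul₀ hφm.aemeasurable]
    · refine (enorm_integral_le_lintegral_enorm _).trans (le_of_eq ?_)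
      refine lintegral_congr fun t => ?_
      simp only [ContinuousLinearMap.lsmul_apply, enorm_smul, Pi.mul_apply,
        Real.enorm_of_nonneg (hφ0 t)]
    · exact (hg.comp_quasiMeasurePreserving (quasiMeasurePreserving_sub_left volume x)).enorm
  calc ∫⁻ x, ‖(φ ⋆[ContinuousLinearMap.lsmul ℝ ℝ] g) x‖ₑ ^ 2
      ≤ ∫⁻ x, ∫⁻ t, ‖g (x - t)‖ₑ ^ 2 ∂ν ∂volume := by
        refine lintegral_mono fun x => (pow_le_pow_left₀ zero_le (hle x) 2).trans ?_
        exact (sq_lintegral_le ν (hmx x)).trans (by rw [hν, one_mul])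
    _ = ∫⁻ t, ∫⁻ x, ‖g (x - t)‖ₑ ^ 2 ∂volume ∂ν := 
        lintegral_lintegral_swap (f := fun x t => ‖g (x - t)‖ₑ ^ 2) (hm.pow_const 2)
    _ = ∫⁻ x, ‖g x‖ₑ ^ 2 := by
        rw [lintegral_congr fun t => lintegral_sub_right_eq_self (fun x => ‖g x‖ₑ ^ 2) t]
        rw [lintegral_const, hν, mul_one]

/-- The derivative falls on the mollifier, and the weak gradient is tested against `t ↦ φ (x - t)`;
the sign from the chain rule cancels the one from integration by parts. -/
lemma IsWeakGradient.fderiv_convolution {u : Space N → ℝ} {g : Space N → Space N}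
    (h : IsWeakGradient u g) (hu : MemLp u 2 volume) (hg : MemLp g 2 volume)
    {φ : Space N → ℝ} (hφ : ContDiff ℝ ∞ φ) (hc : HasCompactSupport φ) (x : Space N) :
    fderiv ℝ (φ ⋆[ContinuousLinearMap.lsmul ℝ ℝ] u) x
      = innerSL ℝ ((φ ⋆[ContinuousLinearMap.lsmul ℝ ℝ] g) x) := by
  have hul : LocallyIntegrable u volume := hu.locallyIntegrable (by norm_num)
  have hgl : LocallyIntegrable g volume := hg.locallyIntegrable (by norm_num)
  rw [(hc.hasFDerivAt_convolution_left (ContinuousLinearMap.lsmul ℝ ℝ) (hφ.of_le (by simp))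
    hul x).fderiv]
  ext v
  have hce : ConvolutionExists φ g (ContinuousLinearMap.lsmul ℝ ℝ) volume :=
    hc.convolutionExists_left _ hφ.continuous hgl
  have hcd : ConvolutionExists (fderiv ℝ φ) u
      ((ContinuousLinearMap.lsmul ℝ ℝ).precompL (Space N)) volume :=
    (hc.fderiv ℝ).convolutionExists_left _ (hφ.continuous_fderiv (by simp)) hul
  have e1 : ((fderiv ℝ φ ⋆[(ContinuousLinearMap.lsmul ℝ ℝ).precompL (Space N)] u) x) v
      = ∫ t, u t * fderiv ℝ φ (x - t) v := by
    rw [convolution_def, ContinuousLinearMap.integral_apply (hcd x),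
      ← integral_sub_left_eq_self _ volume x]
    refine integral_congr_ae (ae_of_all _ fun t => ?_)
    simp [mul_comm]
  have e2 : innerSL ℝ ((φ ⋆[ContinuousLinearMap.lsmul ℝ ℝ] g) x) v
      = ∫ t, φ (x - t) * inner ℝ (g t) v := by
    rw [convolution_def, innerSL_apply_apply, real_inner_comm, ← integral_inner (hce x),
      ← integral_sub_left_eq_self _ volume x]
    refine integral_congr_ae (ae_of_all _ fun t => ?_)
    simp [inner_smul_right, real_inner_comm]
  rw [e1, e2]
  have hψ : ContDiff ℝ ∞ fun t => φ (x - t) := hφ.comp (contDiff_const.sub contDiff_id)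
  have hψc : HasCompactSupport fun t => φ (x - t) :=
    hc.comp_homeomorph (Homeomorph.subLeft x)
  have key := h _ hψ hψc v
  have hd : ∀ t, fderiv ℝ (fun t => φ (x - t)) t v = - fderiv ℝ φ (x - t) v := by
    intro t
    have h1 : HasFDerivAt (fun t => x - t) (-ContinuousLinearMap.id ℝ (Space N)) t :=
      (hasFDerivAt_id t).const_sub x
    have h2 := ((hφ.differentiable (by simp)) (x - t)).hasFDerivAt.comp t h1
    have h3 : fderiv ℝ (fun t => φ (x - t)) t = _ := h2.fderiv
    rw [h3]; simp
  simp only [hd, mul_neg, integral_neg, neg_inj] at key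
  exact key

/-- Smooth compactly supported functions equal to `1` on large balls, with small gradients. -/
lemma exists_cutoff (N : ℕ) : ∃ C : ℝ, ∀ n : ℕ, ∃ χ : Space N → ℝ, ContDiff ℝ ∞ χ ∧
    HasCompactSupport χ ∧ (∀ x, ‖χ x‖ ≤ 1) ∧ (∀ x, ‖x‖ ≤ n + 1 → χ x = 1) ∧
    ∀ x, ‖fderiv ℝ χ x‖ ≤ C / (n + 1) := by
  -- One fixed bump, rescaled by `1 / (n + 1)`: its derivative is scaled by the same factor, so `C`
  -- is independent of `n`.
  let b : ContDiffBump (0 : Space N) := ⟨1, 2, one_pos, one_lt_two⟩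
  have hb : ContDiff ℝ ∞ b := b.contDiff
  obtain ⟨C, hC⟩ := ((hb.continuous_fderiv (by simp)).bounded_above_of_compact_support
    (b.hasCompactSupport.fderiv ℝ))
  refine ⟨C, fun n => ?_⟩
  have hn : (0 : ℝ) < (n : ℝ) + 1 := by positivity
  set r : ℝ := ((n : ℝ) + 1)⁻¹ with hr
  have hr0 : 0 < r := inv_pos.2 hn
  refine ⟨fun x => b (r • x), hb.comp (contDiff_const_smul r),
    b.hasCompactSupport.comp_smul hr0.ne', fun x => ?_, fun x hx => ?_, fun x => ?_⟩
  · rw [Real.norm_of_nonneg b.nonneg]; exact b.le_one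
  · refine b.one_of_mem_closedBall ?_
    rw [mem_closedBall_zero_iff, norm_smul, Real.norm_of_nonneg hr0.le, hr,
      inv_mul_le_iff₀ hn]
    exact hx.trans_eq (mul_one _).symm
  · have h1 : fderiv ℝ (fun x => b (r • x)) x = r • fderiv ℝ b (r • x) := by
      rw [fderiv_comp_smul]
    rw [h1, norm_smul, Real.norm_of_nonneg hr0.le, div_eq_inv_mul]
    gcongr
    exact hC _

/-- A function with a weak gradient in `L²` is an a.e. limit of test functions whose gradients are
asymptotically no larger in `L²`. -/
lemma IsWeakGradient.exists_approx {u : Space N → ℝ} {g : Space N → Space N}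
    (h : IsWeakGradient u g) (hu : MemLp u 2 volume) (hg : MemLp g 2 volume) :
    ∃ (w : ℕ → Space N → ℝ) (c : ℕ → ℝ≥0∞), (∀ n, ContDiff ℝ ∞ (w n)) ∧
      (∀ n, HasCompactSupport (w n)) ∧ (∀ᵐ x, Tendsto (fun n => w n x) atTop (𝓝 (u x))) ∧
      (∀ n, eLpNorm (fderiv ℝ (w n)) 2 volume ≤ c n) ∧
      Tendsto c atTop (𝓝 (eLpNorm g 2 volume)) := by
  obtain ⟨C, hC⟩ := exists_cutoff N
  choose χ hχ hχc hχ1 hχe hχd using hC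
  let b : ℕ → ContDiffBump (0 : Space N) := fun n =>
    ⟨1 / ((n : ℝ) + 1), 2 * (1 / ((n : ℝ) + 1)), by positivity, by
      have : 0 < 1 / ((n : ℝ) + 1) := by positivity
      linarith⟩
  let m : ℕ → Space N → ℝ := fun n =>
    ((b n).normed volume ⋆[ContinuousLinearMap.lsmul ℝ ℝ] u)
  have hul : LocallyIntegrable u volume := hu.locallyIntegrable (by norm_num)
  have hφ : ∀ n, ContDiff ℝ ∞ ((b n).normed volume) := fun n => (b n).contDiff_normed
  have hφc : ∀ n, HasCompactSupport ((b n).normed volume) := fun n => (b n).hasCompactSupport_normed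
  have hm : ∀ n, ContDiff ℝ ∞ (m n) := fun n =>
    (hφc n).contDiff_convolution_left _ (hφ n) hul
  have hmu : ∀ n, eLpNorm (m n) 2 volume ≤ eLpNorm u 2 volume := fun n =>
    eLpNorm_two_convolution_le (hφ n).continuous (b n).nonneg_normed (b n).integrable_normed
      (b n).integral_normed hu.aestronglyMeasurable
  have hmg : ∀ n, eLpNorm (fderiv ℝ (m n)) 2 volume ≤ eLpNorm g 2 volume := fun n => by
    refine le_trans (le_of_eq ?_) (eLpNorm_two_convolution_le (hφ n).continuous
      (b n).nonneg_normed (b n).integrable_normed (b n).integral_normed hg.aestronglyMeasurable)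
    refine eLpNorm_congr_norm_ae (ae_of_all _ fun x => ?_)
    rw [h.fderiv_convolution hu hg (hφ n) (hφc n), innerSL_apply_norm]
  have htend : Tendsto (fun n : ℕ => 1 / ((n : ℝ) + 1)) atTop (𝓝 0) :=
    tendsto_one_div_add_atTop_nhds_zero_nat
  refine ⟨fun n x => χ n x * m n x,
    -- The vanishing second term comes from the derivative falling on the cutoff.
    fun n => eLpNorm g 2 volume + ENNReal.ofReal (C / (n + 1)) * eLpNorm u 2 volume,
    fun n => (hχ n).mul (hm n), fun n => (hχc n).mul_right, ?_, fun n => ?_, ?_⟩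
  -- Almost everywhere convergence of the mollifications is Lebesgue differentiation, which needs
  -- the ratio of the outer to the inner radius bounded, here by `K = 2`. At a fixed `x` the cutoff
  -- is eventually `1`.
  · have hconv := ContDiffBump.ae_convolution_tendsto_right_of_locallyIntegrable (φ := b)
      (l := atTop) (K := 2) (by simpa only [mul_zero] using htend.const_mul 2)
      (Eventually.of_forall fun n => le_rfl) hul
    filter_upwards [hconv] with x hx
    refine hx.congr' ?_
    filter_upwards [eventually_ge_atTop ⌈‖x‖⌉₊] with n hn
    rw [hχe n x ((Nat.ceil_le.1 hn).trans (by linarith)), one_mul]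
  · have hd : fderiv ℝ (fun x => χ n x * m n x)
        = (fun x => χ n x • fderiv ℝ (m n) x) + fun x => m n x • fderiv ℝ (χ n) x := by
      funext x
      exact fderiv_mul ((hχ n).differentiable (by simp) x) ((hm n).differentiable (by simp) x)
    have hdm := (hm n).continuous_fderiv (by simp)
    have hdχ := (hχ n).continuous_fderiv (by simp)
    rw [hd]
    refine (eLpNorm_add_le ((hχ n).continuous.smul hdm).aestronglyMeasurable
      ((hm n).continuous.smul hdχ).aestronglyMeasurable (by norm_num)).trans ?_
    refine add_le_add (le_trans (eLpNorm_mono fun x => ?_) (hmg n)) ?_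
    · rw [Pi.smul_apply', norm_smul]
      exact mul_le_of_le_one_left (norm_nonneg _) (hχ1 n x)
    · refine le_trans (eLpNorm_le_mul_eLpNorm_of_ae_le_mul (c := C / (n + 1))
        (ae_of_all _ fun x => ?_) 2) (mul_le_mul_right (hmu n) _)
      rw [Pi.smul_apply', norm_smul, mul_comm]
      exact mul_le_mul_of_nonneg_right (hχd n x) (norm_nonneg _)
  · have h0 : Tendsto (fun n : ℕ => ENNReal.ofReal (C / (n + 1))) atTop (𝓝 0) := by
      have : Tendsto (fun n : ℕ => C / ((n : ℝ) + 1)) atTop (𝓝 0) := by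
        simpa [div_eq_mul_inv] using htend.const_mul C
      simpa using ENNReal.tendsto_ofReal this
    have h1 := ENNReal.Tendsto.mul_const h0 (Or.inr hu.eLpNorm_ne_top)
    rw [zero_mul] at h1
    simpa using h1.const_add (eLpNorm g 2 volume)

/-! ### The Sobolev inequality -/

lemma criticalExponent_eq (hN : 3 ≤ N) :
    ∃ p : ℝ≥0, criticalExponent N = p ∧ (p : ℝ)⁻¹ = 2⁻¹ - (N : ℝ)⁻¹ ∧ (2 : ℝ) < p := by
  have hN' : (3 : ℝ) ≤ N := by exact_mod_cast hN
  refine ⟨(2 * (N : ℝ) / ((N : ℝ) - 2)).toNNReal, rfl, ?_⟩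
  have hp : 0 ≤ 2 * (N : ℝ) / ((N : ℝ) - 2) := div_nonneg (by linarith) (by linarith)
  rw [Real.coe_toNNReal _ hp]
  refine ⟨?_, ?_⟩
  · rw [inv_div]
    field_simp
  · rw [lt_div_iff₀ (by linarith)]
    linarith

/-- The Sobolev inequality for functions with a weak gradient in `L²`. -/
lemma exists_sobolev (hN : 3 ≤ N) : ∃ K : ℝ≥0, ∀ (u : Space N → ℝ) (g : Space N → Space N),
    IsWeakGradient u g → MemLp u 2 volume → MemLp g 2 volume →
    eLpNorm u (criticalExponent N) volume ≤ K * eLpNorm g 2 volume := by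
  obtain ⟨p, hp, hp', -⟩ := criticalExponent_eq hN
  refine ⟨eLpNormLESNormFDerivOfEqInnerConst (volume : Measure (Space N)) 2,
    fun u g h hu hg => ?_⟩
  obtain ⟨w, c, hw, hwc, hlim, hle, hc⟩ := h.exists_approx hu hg
  rw [hp]
  refine eLpNorm_le_of_ae_tendsto (fun n => (hw n).continuous.aestronglyMeasurable) hlim
    (fun n => ?_) (ENNReal.Tendsto.const_mul hc (Or.inr ENNReal.coe_ne_top))
  refine (eLpNorm_le_eLpNorm_fderiv_of_eq_inner (p := 2) (p' := p) volume
    ((hw n).of_le (by simp)) (hwc n) (by norm_num) (by simp; omega) (by simpa using hp')).trans ?_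
  simpa using mul_le_mul_right (hle n) _

/-! ### Translation estimate in `L²` -/

/-- Jensen in `t` on an interval of length one, then Tonelli and the translation invariance of
Lebesgue measure. -/
lemma lintegral_comp_add_smul_le {F : Type*} [NormedAddCommGroup F] {f : Space N → F}
    (hf : Continuous f) (z : Space N) :
    ∫⁻ x, (∫⁻ t in Set.Ioc (0 : ℝ) 1, ‖f (x + t • z)‖ₑ) ^ 2 ≤ ∫⁻ x, ‖f x‖ₑ ^ 2 := by
  have hm : Continuous fun p : Space N × ℝ => ‖f (p.1 + p.2 • z)‖ₑ := by fun_prop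
  calc ∫⁻ x, (∫⁻ t in Set.Ioc (0 : ℝ) 1, ‖f (x + t • z)‖ₑ) ^ 2
      ≤ ∫⁻ x, ∫⁻ t in Set.Ioc (0 : ℝ) 1, ‖f (x + t • z)‖ₑ ^ 2 := by
        refine lintegral_mono fun x => ?_
        refine (sq_lintegral_le _ ?_).trans ?_
        · exact Continuous.aemeasurable (by fun_prop)
        · simp
    _ = ∫⁻ t in Set.Ioc (0 : ℝ) 1, ∫⁻ x, ‖f (x + t • z)‖ₑ ^ 2 :=
        lintegral_lintegral_swap (f := fun x t => ‖f (x + t • z)‖ₑ ^ 2)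
          (hm.measurable.pow_const 2).aemeasurable
    _ = ∫⁻ x, ‖f x‖ₑ ^ 2 := by
        rw [lintegral_congr fun t : ℝ =>
          lintegral_add_right_eq_self (fun x => ‖f x‖ₑ ^ 2) (t • z)]
        simp

/-- The fundamental theorem of calculus on the segment from `x` to `x + z` bounds the difference by
`|z|` times the mean of the gradient norm there. -/
lemma eLpNorm_translate_sub_le_of_contDiff {w : Space N → ℝ} (hw : ContDiff ℝ 1 w) (z : Space N) :
    eLpNorm (fun x => w (x + z) - w x) 2 volume ≤ ‖z‖ₑ * eLpNorm (fderiv ℝ w) 2 volume := by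
  have hd : Continuous (fderiv ℝ w) := hw.continuous_fderiv one_ne_zero
  have hpt : ∀ x, ‖w (x + z) - w x‖ₑ
      ≤ ‖z‖ₑ * ∫⁻ t in Set.Ioc (0 : ℝ) 1, ‖fderiv ℝ w (x + t • z)‖ₑ := by
    intro x
    have hderiv : ∀ t : ℝ, HasDerivAt (fun t : ℝ => w (x + t • z)) (fderiv ℝ w (x + t • z) z) t := by
      intro t
      have h1 : HasDerivAt (fun t : ℝ => x + t • z) z t := by
        simpa using ((hasDerivAt_id t).smul_const z).const_add x
      exact ((hw.differentiable one_ne_zero) _).hasFDerivAt.comp_hasDerivAt t h1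
    have hcont : Continuous fun t : ℝ => fderiv ℝ w (x + t • z) z := by fun_prop
    have hint := intervalIntegral.integral_eq_sub_of_hasDerivAt (fun t _ => hderiv t)
      (hcont.intervalIntegrable 0 1)
    simp only [one_smul, zero_smul, add_zero] at hint
    rw [← hint, intervalIntegral.integral_of_le zero_le_one]
    refine (enorm_integral_le_lintegral_enorm _).trans ?_
    rw [← lintegral_const_mul _ (by fun_prop)]
    refine lintegral_mono fun t => ?_
    rw [mul_comm]
    exact ContinuousLinearMap.le_opENorm _ _
  have hsq : eLpNorm (fun x => w (x + z) - w x) 2 volume ^ 2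
      ≤ (‖z‖ₑ * eLpNorm (fderiv ℝ w) 2 volume) ^ 2 := by
    rw [mul_pow, eLpNorm_two_sq, eLpNorm_two_sq]
    calc ∫⁻ x, ‖w (x + z) - w x‖ₑ ^ 2
        ≤ ∫⁻ x, ‖z‖ₑ ^ 2 * (∫⁻ t in Set.Ioc (0 : ℝ) 1, ‖fderiv ℝ w (x + t • z)‖ₑ) ^ 2 := by
          refine lintegral_mono fun x => ?_
          rw [← mul_pow]
          exact pow_le_pow_left₀ zero_le (hpt x) 2
      _ ≤ _ := by
          rw [lintegral_const_mul' _ _ (by simp)]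
          exact mul_le_mul_right (lintegral_comp_add_smul_le hd z) _
  exact (ENNReal.pow_right_strictMono two_ne_zero).le_iff_le.1 hsq

lemma IsWeakGradient.eLpNorm_translate_sub_le {u : Space N → ℝ} {g : Space N → Space N}
    (h : IsWeakGradient u g) (hu : MemLp u 2 volume) (hg : MemLp g 2 volume) (z : Space N) :
    eLpNorm (fun x => u (x + z) - u x) 2 volume ≤ ‖z‖ₑ * eLpNorm g 2 volume := by
  obtain ⟨w, c, hw, -, hlim, hle, hc⟩ := h.exists_approx hu hg
  have hlim' : ∀ᵐ x, Tendsto (fun n => w n (x + z)) atTop (𝓝 (u (x + z))) :=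
    (measurePreserving_add_right volume z).quasiMeasurePreserving.ae hlim
  refine eLpNorm_le_of_ae_tendsto (f := fun n x => w n (x + z) - w n x)
    (fun n => ?_) ?_ (fun n => ?_) (ENNReal.Tendsto.const_mul hc (Or.inr (by simp)))
  · have := (hw n).continuous
    exact Continuous.aestronglyMeasurable (by fun_prop)
  · filter_upwards [hlim, hlim'] with x h1 h2 using h2.sub h1
  · exact (eLpNorm_translate_sub_le_of_contDiff ((hw n).of_le (by simp)) z).trans
      (mul_le_mul_right (hle n) _)

/-! ### Interpolation of norms and of compactness -/

/-- Interpolation of `L^q` norms. -/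
lemma exists_eLpNorm_interpolation {p q r : ℝ} (hp : 0 < p) (hpq : p ≤ q) (hqr : q ≤ r)
    (hpr : p < r) : ∃ θ : ℝ, 0 ≤ θ ∧ θ ≤ 1 ∧ (q < r → 0 < θ) ∧
      ∀ {α : Type} [MeasurableSpace α] (μ : Measure α) (f : α → ℝ), AEStronglyMeasurable f μ →
      eLpNorm f (ENNReal.ofReal q) μ ≤
        eLpNorm f (ENNReal.ofReal p) μ ^ θ * eLpNorm f (ENNReal.ofReal r) μ ^ (1 - θ) := by
  have hq : 0 < q := hp.trans_le hpq
  have hr : 0 < r := hp.trans hpr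
  have hd : 0 < r - p := sub_pos.2 hpr
  -- Convex weights with `q = p a + r b`. Hölder gives `∫ |f|^q ≤ (∫ |f|^p)^a (∫ |f|^r)^b`; taking
  -- `q`-th roots gives `θ = p a / q`.
  set a : ℝ := (r - q) / (r - p) with ha
  set b : ℝ := (q - p) / (r - p) with hb
  have ha0 : 0 ≤ a := div_nonneg (by linarith) hd.le
  have hb0 : 0 ≤ b := div_nonneg (by linarith) hd.le
  have hab : a + b = 1 := by rw [ha, hb]; field_simp; ring
  have hq' : p * a + r * b = q := by rw [ha, hb]; field_simp; ring
  have hθ : 1 - p * a / q = r * b / q := by rw [← hq']; rw [← hq'] at hq; field_simp; ring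
  refine ⟨p * a / q, by positivity, ?_, fun hlt => ?_, fun μ f hf => ?_⟩
  · have : 0 ≤ r * b / q := by positivity
    linarith
  · have : 0 < a := div_pos (by linarith) hd
    positivity
  have key := ENNReal.lintegral_mul_norm_pow_le (μ := μ) (f := fun x => ‖f x‖ₑ ^ p)
    (g := fun x => ‖f x‖ₑ ^ r) (hf.enorm.pow_const p) (hf.enorm.pow_const r) ha0 hb0 hab
  have e : ∀ x, (‖f x‖ₑ ^ p) ^ a * (‖f x‖ₑ ^ r) ^ b = ‖f x‖ₑ ^ q := fun x => by
    rw [← ENNReal.rpow_mul, ← ENNReal.rpow_mul,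
      ← ENNReal.rpow_add_of_nonneg _ _ (by positivity) (by positivity), hq']
  simp only [e] at key
  have f1 : ∀ s : ℝ, 0 < s → eLpNorm f (ENNReal.ofReal s) μ = (∫⁻ x, ‖f x‖ₑ ^ s ∂μ) ^ (1 / s) :=
    fun s hs => by
      rw [eLpNorm_eq_lintegral_rpow_enorm_toReal (by simpa using hs) (by simp),
        ENNReal.toReal_ofReal hs.le]
  rw [f1 p hp, f1 q hq, f1 r hr, hθ, ← ENNReal.rpow_mul, ← ENNReal.rpow_mul]
  calc (∫⁻ x, ‖f x‖ₑ ^ q ∂μ) ^ (1 / q)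
      ≤ ((∫⁻ x, ‖f x‖ₑ ^ p ∂μ) ^ a * (∫⁻ x, ‖f x‖ₑ ^ r ∂μ) ^ b) ^ (1 / q) := by gcongr
    _ = _ := by
      rw [ENNReal.mul_rpow_of_nonneg _ _ (by positivity), ← ENNReal.rpow_mul, ← ENNReal.rpow_mul]
      congr 2 <;> field_simp

/-- Compactness passes from `T` to `S` through an interpolation inequality. -/
lemma isCompactOperator_of_interpolation {V Y Z : Type*} [NormedAddCommGroup V] [NormedSpace ℝ V]
    [NormedAddCommGroup Y] [NormedSpace ℝ Y] [NormedAddCommGroup Z] [NormedSpace ℝ Z]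
    [CompleteSpace Z] {T : V →L[ℝ] Y} {S : V →L[ℝ] Z} {C θ : ℝ} (hC : 0 ≤ C) (hθ : 0 < θ)
    (hθ1 : θ ≤ 1) (h : ∀ u, ‖S u‖ ≤ C * ‖T u‖ ^ θ * ‖u‖ ^ (1 - θ)) (hT : IsCompactOperator T) :
    IsCompactOperator S := by
  have hTc := hT.isCompact_closure_image_ball (f := T.toLinearMap) 1
  refine (isCompactOperator_iff_isCompact_closure_image_ball S.toLinearMap one_pos).2 ?_
  refine isCompact_iff_totallyBounded_isComplete.2
    ⟨TotallyBounded.closure ?_, isClosed_closure.isComplete⟩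
  have hTB : TotallyBounded (T '' Metric.ball 0 1) := hTc.totallyBounded.subset subset_closure
  rw [Metric.totallyBounded_iff]
  intro ε hε
  -- The factor `2` bounds the distance between two points of the unit ball. Positivity of `θ` makes
  -- the limit zero.
  have hlim : Tendsto (fun δ : ℝ => C * δ ^ θ * 2 ^ (1 - θ)) (𝓝 0) (𝓝 0) := by
    have : ContinuousAt (fun δ : ℝ => C * δ ^ θ * (2 : ℝ) ^ (1 - θ)) 0 :=
      (continuousAt_const.mul (Real.continuousAt_rpow_const _ _ (Or.inr hθ.le))).mul
        continuousAt_const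
    simpa [ContinuousAt, Real.zero_rpow hθ.ne'] using this
  obtain ⟨δ, hδε, hδ⟩ : ∃ δ : ℝ, C * δ ^ θ * 2 ^ (1 - θ) < ε ∧ 0 < δ :=
    (((hlim.mono_left nhdsWithin_le_nhds).eventually (gt_mem_nhds hε)).and
      (self_mem_nhdsWithin (s := Set.Ioi (0 : ℝ)))).exists
  -- The net is taken inside the image of the ball, so that its points lift to the ball; the images
  -- of these lifts under `S` form the `ε`-net.
  obtain ⟨t, hts, htf, htc⟩ := totallyBounded_iff_subset.1 hTB _ (Metric.dist_mem_uniformity hδ)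
  choose! a ha using fun y (hy : y ∈ t) => hts hy
  refine ⟨(fun y => S (a y)) '' t, htf.image _, ?_⟩
  rintro _ ⟨u, hu, rfl⟩
  obtain ⟨y, hy, hyu⟩ := Set.mem_iUnion₂.1 (htc (Set.mem_image_of_mem T hu))
  refine Set.mem_iUnion₂.2 ⟨_, Set.mem_image_of_mem _ hy, ?_⟩
  have h1 : ‖T (u - a y)‖ ≤ δ := by
    rw [map_sub, (ha y hy).2, ← dist_eq_norm]
    exact le_of_lt hyu
  have h2 : ‖u - a y‖ ≤ 2 := by
    have hu' := mem_ball_zero_iff.1 hu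
    have hay := mem_ball_zero_iff.1 (ha y hy).1
    linarith [norm_sub_le u (a y)]
  rw [Metric.mem_ball, dist_eq_norm]
  have := h (u - a y)
  rw [map_sub S] at this
  refine lt_of_le_of_lt (this.trans ?_) hδε
  gcongr

lemma two_le_criticalExponent (hN : 3 ≤ N) : 2 ≤ criticalExponent N := by
  obtain ⟨p, hp, -, h2⟩ := criticalExponent_eq hN
  rw [hp]
  exact_mod_cast h2.le

/-! ### Bounds by the energy norm -/

section Energy

variable [NeZero N]

lemma X.enorm_sq_eq (u : X N) :
    ‖u‖ₑ ^ 2 = ∫⁻ x, ENNReal.ofReal (energyDensity (toH1 u) x) := by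
  rw [← ofReal_norm, ← ENNReal.ofReal_pow (norm_nonneg _), X.norm_sq_eq,
    ofReal_integral_eq_lintegral_ofReal (X.integrable_energyDensity u)
      (ae_of_all _ (X.energyDensity_nonneg _))]

lemma X.eLpNorm_weakGrad_le (u : X N) : eLpNorm (weakGrad (toH1 u)) 2 volume ≤ ‖u‖ₑ := by
  rw [← (ENNReal.pow_right_strictMono two_ne_zero).le_iff_le]
  rw [eLpNorm_two_sq, X.enorm_sq_eq]
  refine lintegral_mono fun x => ?_
  rw [← ofReal_norm, ← ENNReal.ofReal_pow (norm_nonneg _)]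
  refine ENNReal.ofReal_le_ofReal (le_add_of_nonneg_right ?_)
  positivity

lemma X.eLpNorm_weight_le (u : X N) :
    eLpNorm (fun x => ‖x‖ * toLp u x) 2 volume ≤ ‖u‖ₑ := by
  rw [← (ENNReal.pow_right_strictMono two_ne_zero).le_iff_le]
  rw [eLpNorm_two_sq, X.enorm_sq_eq]
  refine lintegral_mono fun x => ?_
  rw [← ofReal_norm, ← ENNReal.ofReal_pow (norm_nonneg _)]
  refine ENNReal.ofReal_le_ofReal ?_
  rw [norm_mul, norm_norm, mul_pow, Real.norm_eq_abs, sq_abs]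
  exact le_add_of_nonneg_left (sq_nonneg _)

lemma X.exists_critical_bound (hN : 3 ≤ N) : ∃ C : ℝ≥0, ∀ u : X N,
    eLpNorm (toLp u) (criticalExponent N) volume ≤ C * ‖u‖ₑ := by
  obtain ⟨K, hK⟩ := exists_sobolev hN
  exact ⟨K, fun u => (hK _ _ (isWeakGradient_weakGrad (toH1 u)) (Lp.memLp _) (Lp.memLp _)).trans
    (mul_le_mul_right (X.eLpNorm_weakGrad_le u) _)⟩

/-- The weight `|x|²` degenerates at the origin, so the unit ball is handled by Hölder from
`L^{2^*}`; outside it the weight is at least `1`. -/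
lemma X.exists_two_bound (hN : 3 ≤ N) : ∃ C : ℝ≥0, ∀ u : X N,
    eLpNorm (toLp u) 2 volume ≤ C * ‖u‖ₑ := by
  obtain ⟨K, hK⟩ := X.exists_critical_bound hN
  let B : Set (Space N) := Metric.ball 0 1
  have hB : MeasurableSet B := measurableSet_ball
  obtain ⟨p, hp, -, h2⟩ := criticalExponent_eq hN
  obtain ⟨c, hc⟩ : ∃ c, c = volume B ^ (1 / (2 : ℝ≥0∞).toReal - 1 / (criticalExponent N).toReal) :=
    ⟨_, rfl⟩
  have hct : c ≠ ⊤ := by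
    rw [hc]
    refine ENNReal.rpow_ne_top_of_nonneg ?_ measure_ball_lt_top.ne
    rw [hp]
    have : (1 : ℝ) / p ≤ 1 / 2 := one_div_le_one_div_of_le (by norm_num) h2.le
    simpa using this
  lift c to ℝ≥0 using hct
  refine ⟨K * c + 1, fun u => ?_⟩
  have hm : AEStronglyMeasurable (toLp u) volume := Lp.aestronglyMeasurable _
  have hin : eLpNorm (B.indicator (toLp u)) 2 volume ≤ K * c * ‖u‖ₑ := by
    rw [eLpNorm_indicator_eq_eLpNorm_restrict hB]
    refine (eLpNorm_le_eLpNorm_mul_rpow_measure_univ (two_le_criticalExponent hN)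
      hm.restrict).trans ?_
    rw [Measure.restrict_apply_univ, ← hc, mul_right_comm]
    gcongr
    exact (eLpNorm_mono_measure _ Measure.restrict_le_self).trans (hK u)
  have hout : eLpNorm (Bᶜ.indicator (toLp u)) 2 volume ≤ ‖u‖ₑ := by
    refine (eLpNorm_mono fun x => ?_).trans (X.eLpNorm_weight_le u)
    by_cases hx : x ∈ B
    · rw [Set.indicator_of_notMem (by simpa using hx), norm_zero]
      exact norm_nonneg _
    · rw [Set.indicator_of_mem (Set.mem_compl hx), norm_mul, norm_norm]
      have : 1 ≤ ‖x‖ := by simpa [B] using hx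
      exact le_mul_of_one_le_left (norm_nonneg _) this
  calc eLpNorm (toLp u) 2 volume
      = eLpNorm (B.indicator (toLp u) + Bᶜ.indicator (toLp u)) 2 volume := by
        rw [Set.indicator_self_add_compl]
    _ ≤ _ := eLpNorm_add_le (hm.indicator hB) (hm.indicator hB.compl) (by norm_num)
    _ ≤ K * c * ‖u‖ₑ + ‖u‖ₑ := add_le_add hin hout
    _ = _ := by push_cast; ring

/-- The inequality between the `L²`, `L^q` and `L^{2^*}` norms on `X`. -/
lemma X.exists_interpolation (hN : 3 ≤ N) {q : ℝ≥0∞} (hq : 2 ≤ q)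
    (hq' : q ≤ criticalExponent N) : ∃ (C : ℝ≥0) (θ : ℝ), 0 ≤ θ ∧ θ ≤ 1 ∧
      (q < criticalExponent N → 0 < θ) ∧ ∀ u : X N,
        eLpNorm (toLp u) q volume ≤ C * eLpNorm (toLp u) 2 volume ^ θ * ‖u‖ₑ ^ (1 - θ) := by
  obtain ⟨p, hp, -, h2⟩ := criticalExponent_eq hN
  obtain ⟨K, hK⟩ := X.exists_critical_bound hN
  have hqt : q ≠ ⊤ := (hq'.trans_lt (by rw [hp]; exact ENNReal.coe_lt_top)).ne
  lift q to ℝ≥0 using hqt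
  rw [hp] at hq' ⊢
  have hq2 : (2 : ℝ) ≤ q := by exact_mod_cast hq
  have hqp : (q : ℝ) ≤ p := by exact_mod_cast hq'
  obtain ⟨θ, h0, h1, hlt, H⟩ := exists_eLpNorm_interpolation two_pos hq2 hqp h2
  refine ⟨K ^ (1 - θ), θ, h0, h1, fun h => hlt (by exact_mod_cast h), fun u => ?_⟩
  have := H volume (toLp u) (Lp.aestronglyMeasurable _)
  simp only [ENNReal.ofReal_coe_nnreal, ENNReal.ofReal_ofNat] at this
  refine this.trans ?_
  rw [ENNReal.coe_rpow_of_nonneg _ (sub_nonneg.2 h1), mul_right_comm,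
    ← ENNReal.mul_rpow_of_nonneg _ _ (sub_nonneg.2 h1), mul_comm]
  have hKu := hK u
  rw [hp] at hKu
  gcongr

lemma X.exists_bound (hN : 3 ≤ N) {q : ℝ≥0∞} (hq : 2 ≤ q) (hq' : q ≤ criticalExponent N) :
    ∃ C : ℝ≥0, ∀ u : X N, eLpNorm (toLp u) q volume ≤ C * ‖u‖ₑ := by
  obtain ⟨C, θ, h0, h1, -, H⟩ := X.exists_interpolation hN hq hq'
  obtain ⟨D, hD⟩ := X.exists_two_bound hN
  refine ⟨C * D ^ θ, fun u => (H u).trans ?_⟩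
  calc C * eLpNorm (toLp u) 2 volume ^ θ * ‖u‖ₑ ^ (1 - θ)
      ≤ C * (D * ‖u‖ₑ) ^ θ * ‖u‖ₑ ^ (1 - θ) := by
        gcongr
        exact hD u
    _ = C * D ^ θ * (‖u‖ₑ ^ θ * ‖u‖ₑ ^ (1 - θ)) := by
        rw [ENNReal.mul_rpow_of_nonneg _ _ h0]; ring
    _ = _ := by
        rw [← ENNReal.rpow_add_of_nonneg _ _ h0 (sub_nonneg.2 h1), add_sub_cancel,
          ENNReal.rpow_one, ENNReal.coe_mul, ENNReal.coe_rpow_of_nonneg _ h0]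

lemma X.exists_embedding {q : ℝ≥0∞} [Fact (1 ≤ q)] {C : ℝ≥0}
    (h : ∀ u : X N, eLpNorm (toLp u) q volume ≤ C * ‖u‖ₑ) :
    ∃ ι : X N →L[ℝ] Lp ℝ q (volume : Measure (Space N)), ∀ u, ι u =ᵐ[volume] toLp u := by
  have hmem : ∀ u : X N, MemLp (toLp u) q volume := fun u =>
    ⟨Lp.aestronglyMeasurable _, (h u).trans_lt (ENNReal.mul_lt_top ENNReal.coe_lt_top (by simp))⟩
  let L : X N →ₗ[ℝ] Lp ℝ q (volume : Measure (Space N)) :=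
    { toFun := fun u => (hmem u).toLp _
      map_add' := fun u w => by
        rw [← MemLp.toLp_add, MemLp.toLp_eq_toLp_iff, map_add]
        exact Lp.coeFn_add _ _
      map_smul' := fun c u => by
        rw [RingHom.id_apply, ← MemLp.toLp_const_smul, MemLp.toLp_eq_toLp_iff, map_smul]
        exact Lp.coeFn_smul _ _ }
  refine ⟨L.mkContinuous C fun u => ?_, fun u => (hmem u).coeFn_toLp⟩
  change ‖(hmem u).toLp _‖ ≤ _
  rw [Lp.norm_toLp]
  refine ENNReal.toReal_le_of_le_ofReal (by positivity) ((h u).trans_eq ?_)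
  rw [ENNReal.ofReal_mul C.coe_nonneg, ENNReal.ofReal_coe_nnreal, ofReal_norm]

end Energy

/-! ### Averages over a grid of cubes -/

/-- The index of the cube of side `1 / n` of the standard grid that contains `x`. -/
noncomputable def cellIndex (n : ℕ) (x : Space N) : Fin N → ℤ := fun i => ⌊(n : ℝ) * x i⌋

/-- The cubes of side `1 / n` of the standard grid. -/
def cell (n : ℕ) (k : Fin N → ℤ) : Set (Space N) := {x | cellIndex n x = k}

/-- The indices of the cubes that cover the ball of radius `n`. -/
noncomputable def cellFinset (N n : ℕ) : Finset (Fin N → ℤ) :=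
  Fintype.piFinset fun _ => Finset.Icc (-(n : ℤ) ^ 2) ((n : ℤ) ^ 2)

lemma cell_eq_preimage {n : ℕ} (hn : 0 < n) (k : Fin N → ℤ) : cell n k =
    (WithLp.ofLp : Space N → Fin N → ℝ) ⁻¹'
      Set.pi Set.univ fun i => Set.Ico ((k i : ℝ) / n) (((k i : ℝ) + 1) / n) := by
  have hn' : (0 : ℝ) < n := by exact_mod_cast hn
  ext x
  simp only [cell, cellIndex, Set.mem_ofPred_eq, funext_iff, Int.floor_eq_iff, Set.mem_preimage,
    Set.mem_pi, Set.mem_univ, true_imp_iff, Set.mem_Ico, div_le_iff₀ hn', lt_div_iff₀ hn',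
    mul_comm]

lemma measurableSet_cell {n : ℕ} (hn : 0 < n) (k : Fin N → ℤ) : MeasurableSet (cell n k) := by
  rw [cell_eq_preimage hn]
  exact (PiLp.volume_preserving_ofLp (Fin N)).measurable
    (MeasurableSet.univ_pi fun i => measurableSet_Ico)

lemma volume_cell {n : ℕ} (hn : 0 < n) (k : Fin N → ℤ) :
    volume (cell n k) = ENNReal.ofReal (1 / n) ^ N := by
  rw [cell_eq_preimage hn, (PiLp.volume_preserving_ofLp (Fin N)).measure_preimage
    (MeasurableSet.univ_pi fun i => measurableSet_Ico).nullMeasurableSet, volume_pi_pi]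
  simp only [Real.volume_Ico]
  rw [Finset.prod_congr rfl fun i _ => by rw [← sub_div, add_sub_cancel_left]]
  simp

lemma norm_sub_le_of_mem_cell {n : ℕ} (hn : 0 < n) {k : Fin N → ℤ} {x y : Space N}
    (hx : x ∈ cell n k) (hy : y ∈ cell n k) : ‖y - x‖ ≤ N / n := by
  have hn' : (0 : ℝ) < n := by exact_mod_cast hn
  have h : ∀ i, ‖(y - x) i‖ ≤ 1 / n := by
    intro i
    have h1 := Int.floor_eq_iff.1 (congrFun hx i)
    have h2 := Int.floor_eq_iff.1 (congrFun hy i)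
    rw [le_div_iff₀ hn', PiLp.sub_apply, Real.norm_eq_abs, ← abs_of_pos hn', ← abs_mul,
      abs_le, sub_mul]
    constructor <;> linarith
  rw [EuclideanSpace.norm_eq]
  refine Real.sqrt_le_iff.2 ⟨by positivity, ?_⟩
  calc ∑ i, ‖(y - x) i‖ ^ 2 ≤ ∑ _i : Fin N, (1 / (n : ℝ)) ^ 2 :=
        Finset.sum_le_sum fun i _ => pow_le_pow_left₀ (norm_nonneg _) (h i) 2
    _ = N * (1 / n) ^ 2 := by simp
    _ ≤ (N : ℝ) ^ 2 * (1 / n) ^ 2 := by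
        gcongr
        exact_mod_cast Nat.le_self_pow two_ne_zero N
    _ = _ := by ring

/-- If `|x| < n`, every `n x_i` lies in `[-n², n²]`, and so does its floor. -/
lemma le_norm_of_cellIndex_notMem {n : ℕ} {x : Space N}
    (hx : cellIndex n x ∉ cellFinset N n) : (n : ℝ) ≤ ‖x‖ := by
  by_contra! h
  refine hx (Fintype.mem_piFinset.2 fun i => Finset.mem_Icc.2 ?_)
  have h1 : |x i| ≤ n := (PiLp.norm_apply_le x i).trans h.le
  have h2 := abs_le.1 h1
  have hn : (0 : ℝ) ≤ n := by positivity
  constructor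
  · refine Int.le_floor.2 ?_
    push_cast
    nlinarith
  · have : ((⌊(n : ℝ) * x i⌋ : ℤ) : ℝ) ≤ ((n ^ 2 : ℤ) : ℝ) := by
      push_cast
      exact (Int.floor_le _).trans (by nlinarith)
    exact_mod_cast this

/-- The function whose value on each of finitely many cubes is the mean of `f` on the cube. -/
noncomputable def cellAverage (n : ℕ) (f : Space N → ℝ) (x : Space N) : ℝ :=
  if cellIndex n x ∈ cellFinset N n then (n : ℝ) ^ N * ∫ y in cell n (cellIndex n x), f y else 0

lemma volume_cell_ne_top {n : ℕ} (hn : 0 < n) (k : Fin N → ℤ) : volume (cell n k) ≠ ⊤ := by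
  rw [volume_cell hn]
  exact ENNReal.pow_ne_top ENNReal.ofReal_ne_top

/-- Averaging over cubes is a compact operator of `L²`. -/
lemma exists_compact_cellAverage {n : ℕ} (hn : 0 < n) :
    ∃ A : Lp ℝ 2 (volume : Measure (Space N)) →L[ℝ] Lp ℝ 2 (volume : Measure (Space N)),
      IsCompactOperator A ∧ ∀ f, A f =ᵐ[volume] cellAverage n f := by
  let e : (Fin N → ℤ) → Lp ℝ 2 (volume : Measure (Space N)) := fun k =>
    indicatorConstLp 2 (measurableSet_cell hn k) (volume_cell_ne_top hn k) (1 : ℝ)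
  let A : (Fin N → ℤ) → Lp ℝ 2 (volume : Measure (Space N)) →L[ℝ]
      Lp ℝ 2 (volume : Measure (Space N)) := fun k =>
    -- Rank one: pairing with the indicator integrates over the cube, and `n ^ N` is the inverse of
    -- its volume.
    (ContinuousLinearMap.toSpanSingleton ℝ (((n : ℝ) ^ N) • e k)).comp (innerSL ℝ (e k))
  refine ⟨∑ k ∈ cellFinset N n, A k, ?_, fun f => ?_⟩
  · refine Submodule.sum_mem (compactOperator (RingHom.id ℝ)
      (Lp ℝ 2 (volume : Measure (Space N))) (Lp ℝ 2 (volume : Measure (Space N)))) fun k _ => ?_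
    have h : IsCompactOperator (innerSL ℝ (e k)) :=
      isCompactOperator_of_locallyCompactSpace_dom _
    exact h.clm_comp (ContinuousLinearMap.toSpanSingleton ℝ (((n : ℝ) ^ N) • e k))
  · have hA : ∀ k, A k f =ᵐ[volume]
        (cell n k).indicator fun _ => (n : ℝ) ^ N * ∫ y in cell n k, f y := by
      intro k
      have h1 : A k f = ((n : ℝ) ^ N * ∫ y in cell n k, f y) • e k := by
        simp only [A, ContinuousLinearMap.comp_apply, innerSL_apply_apply,
          ContinuousLinearMap.toSpanSingleton_apply, smul_smul]
        rw [L2.inner_indicatorConstLp_one, mul_comm]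
      rw [h1]
      filter_upwards [Lp.coeFn_smul ((n : ℝ) ^ N * ∫ y in cell n k, f y) (e k),
        indicatorConstLp_coeFn (p := 2) (hs := measurableSet_cell hn k)
          (hμs := volume_cell_ne_top hn k) (c := (1 : ℝ))] with x hx1 hx2
      rw [hx1, Pi.smul_apply, hx2]
      by_cases hx : x ∈ cell n k <;> simp [hx]
    have hall : ∀ᵐ x ∂(volume : Measure (Space N)), ∀ k, A k f x =
        (cell n k).indicator (fun _ => (n : ℝ) ^ N * ∫ y in cell n k, f y) x :=
      ae_all_iff.2 hA
    rw [sum_apply]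
    filter_upwards [hall, Lp.coeFn_finsetSum (cellFinset N n) fun k => A k f] with x hx hs
    rw [hs, Finset.sum_apply, Finset.sum_congr rfl fun k _ => hx k]
    simp only [Set.indicator_apply, cell, Set.mem_ofPred_eq, Finset.sum_ite_eq, cellAverage]

/-- On a selected cube, Jensen bounds the squared error by the mean of `|f x - f y|²`. The cube,
shifted by `-x`, is then enlarged to a ball independent of `x`, which allows the integrals in `x`
and `z` to be exchanged later. Elsewhere the average is `0` and `|x| ≥ n`. -/
lemma enorm_sub_cellAverage_sq_le {n : ℕ} (hn : 0 < n) {f : Space N → ℝ} (hf : MemLp f 2 volume)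
    (x : Space N) : ‖f x - cellAverage n f x‖ₑ ^ 2 ≤
      (n : ℝ≥0∞) ^ N * (∫⁻ z in Metric.closedBall 0 ((N : ℝ) / n), ‖f (x + z) - f x‖ₑ ^ 2)
        + ENNReal.ofReal (1 / n) ^ 2 * ‖‖x‖ * f x‖ₑ ^ 2 := by
  have hn' : (0 : ℝ) < n := by exact_mod_cast hn
  rw [cellAverage]
  split_ifs with hx
  · refine le_add_right ?_
    have hQt := volume_cell_ne_top hn (cellIndex n x)
    have hQv := volume_cell hn (cellIndex n x)
    have hQm := measurableSet_cell hn (cellIndex n x)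
    have hxQ : x ∈ cell n (cellIndex n x) := rfl
    set Q := cell n (cellIndex n x) with hQ
    have hcard : (n : ℝ≥0∞) ^ N * volume Q = 1 := by
      rw [hQv, ← mul_pow, ← ENNReal.ofReal_natCast, ← ENNReal.ofReal_mul hn'.le,
        mul_one_div_cancel hn'.ne', ENNReal.ofReal_one, one_pow]
    have hfQ : IntegrableOn f Q := by
      have : IsFiniteMeasure (volume.restrict Q) := ⟨by simpa using hQt.lt_top⟩
      exact (hf.restrict Q).integrable (by norm_num)
    have hreal : (n : ℝ) ^ N * volume.real Q = 1 := by
      have := congrArg ENNReal.toReal hcard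
      simpa [Measure.real] using this
    have hcQ : IntegrableOn (fun _ => f x) Q := integrableOn_const hQt
    have hdiff : f x - (n : ℝ) ^ N * ∫ y in Q, f y
        = (n : ℝ) ^ N * ∫ y in Q, (f x - f y) := by
      rw [integral_sub hcQ hfQ, setIntegral_const, smul_eq_mul, mul_sub,
        ← mul_assoc, hreal, one_mul]
    have hm : AEMeasurable (fun y => ‖f x - f y‖ₑ) (volume.restrict Q) :=
      (aestronglyMeasurable_const.sub hf.aestronglyMeasurable.restrict).enorm
    calc ‖f x - (n : ℝ) ^ N * ∫ y in Q, f y‖ₑ ^ 2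
        ≤ ((n : ℝ≥0∞) ^ N * ∫⁻ y in Q, ‖f x - f y‖ₑ) ^ 2 := by
          rw [hdiff, enorm_mul, enorm_pow]
          gcongr
          · simp
          · exact enorm_integral_le_lintegral_enorm _
      _ ≤ ((n : ℝ≥0∞) ^ N) ^ 2 * (volume Q * ∫⁻ y in Q, ‖f x - f y‖ₑ ^ 2) := by
          rw [mul_pow]
          gcongr
          exact (sq_lintegral_le _ hm).trans_eq (by rw [Measure.restrict_apply_univ])
      _ = (n : ℝ≥0∞) ^ N * ((n : ℝ≥0∞) ^ N * volume Q) * ∫⁻ y in Q, ‖f x - f y‖ₑ ^ 2 := by ring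
      _ = (n : ℝ≥0∞) ^ N * ∫⁻ y in Q, ‖f x - f y‖ₑ ^ 2 := by rw [hcard, mul_one]
      _ ≤ _ := by
          refine mul_le_mul_right ?_ _
          rw [← lintegral_indicator hQm, ← lintegral_indicator measurableSet_closedBall,
            ← lintegral_add_left_eq_self _ x]
          refine lintegral_mono fun z => ?_
          by_cases hz : x + z ∈ Q
          · have hzb : z ∈ Metric.closedBall (0 : Space N) ((N : ℝ) / n) := by
              rw [mem_closedBall_zero_iff]
              simpa using norm_sub_le_of_mem_cell hn hxQ hz
            rw [Set.indicator_of_mem hz, Set.indicator_of_mem hzb, ← enorm_neg, neg_sub]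
          · rw [Set.indicator_of_notMem hz]
            exact zero_le
  · refine le_add_left ?_
    rw [sub_zero, ← mul_pow]
    gcongr
    have h1 := le_norm_of_cellIndex_notMem hx
    rw [enorm_mul, enorm_norm, ← mul_assoc]
    refine le_mul_of_one_le_left zero_le ?_
    rw [← ofReal_norm, ← ENNReal.ofReal_mul (by positivity), ENNReal.one_le_ofReal,
      one_div_mul_eq_div, one_le_div₀ hn']
    exact h1

/-- Tonelli, then the translation estimate for each fixed `z` with `|z| ≤ ρ`. -/
lemma lintegral_closedBall_translate_le {f : Space N → ℝ} {g : Space N → Space N}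
    (h : IsWeakGradient f g) (hf : MemLp f 2 volume) (hg : MemLp g 2 volume) (ρ : ℝ) : ∫⁻ x, ∫⁻ z in Metric.closedBall 0 ρ, ‖f (x + z) - f x‖ₑ ^ 2 ≤
      volume (Metric.closedBall (0 : Space N) ρ) * (ENNReal.ofReal ρ * eLpNorm g 2 volume) ^ 2 := by
  have hm : AEMeasurable (fun p : Space N × Space N => ‖f (p.1 + p.2) - f p.1‖ₑ)
      (volume.prod (volume.restrict (Metric.closedBall (0 : Space N) ρ))) := by
    have hac : (volume : Measure (Space N)).prod (volume.restrict (Metric.closedBall (0 : Space N) ρ)) ≪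
        (volume : Measure (Space N)).prod volume :=
      Measure.AbsolutelyContinuous.rfl.prod Measure.restrict_le_self.absolutelyContinuous
    have h1 : AEStronglyMeasurable (fun p : Space N × Space N => f (p.1 + p.2))
        ((volume : Measure (Space N)).prod volume) :=
      hf.aestronglyMeasurable.comp_quasiMeasurePreserving
        (quasiMeasurePreserving_add volume volume)
    have h2 : AEStronglyMeasurable (fun p : Space N × Space N => f p.1)
        ((volume : Measure (Space N)).prod volume) :=
      hf.aestronglyMeasurable.comp_quasiMeasurePreserving Measure.quasiMeasurePreserving_fst
    exact AEStronglyMeasurable.enorm ((h1.sub h2).mono_ac hac)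
  rw [lintegral_lintegral_swap (f := fun x z => ‖f (x + z) - f x‖ₑ ^ 2) (hm.pow_const 2)]
  refine (setLIntegral_mono (g := fun _ => (ENNReal.ofReal ρ * eLpNorm g 2 volume) ^ 2)
    measurable_const fun z hz => ?_).trans_eq ?_
  · rw [← eLpNorm_two_sq]
    refine pow_le_pow_left₀ zero_le ((h.eLpNorm_translate_sub_le hf hg z).trans ?_) 2
    gcongr
    rw [← ofReal_norm]
    exact ENNReal.ofReal_le_ofReal (mem_closedBall_zero_iff.1 hz)
  · rw [setLIntegral_const, mul_comm]

/-! ### Compactness in `L²` -/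

variable [NeZero N]

/-- Functions in a bounded subset of `X` are uniformly close in `L²` to their averages. -/
lemma X.exists_sub_cellAverage_bound (N : ℕ) [NeZero N] : ∃ M : ℝ, ∀ n : ℕ, 0 < n → ∀ u : X N,
    eLpNorm (fun x => toLp u x - cellAverage n (toLp u) x) 2 volume
      ≤ ENNReal.ofReal (M / n) * ‖u‖ₑ := by
  set V : ℝ := volume.real (Metric.closedBall (0 : Space N) 1) with hV
  -- The factor `n ^ N` times the volume of the ball of radius `N / n` is `N ^ N * V`; the squared
  -- translation length supplies `N ^ 2 / n ^ 2`.
  set K : ℝ := (N : ℝ) ^ N * V * N ^ 2 with hK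
  have hV0 : 0 ≤ V := measureReal_nonneg
  have hK0 : 0 ≤ K := by positivity
  refine ⟨K + 1, fun n hn u => ?_⟩
  have hn' : (0 : ℝ) < n := by exact_mod_cast hn
  have hf := Lp.memLp (toLp u)
  have hball : volume (Metric.closedBall (0 : Space N) ((N : ℝ) / n))
      = ENNReal.ofReal ((N / n) ^ N * V) := by
    rw [Measure.addHaar_closedBall' _ _ (by positivity), ENNReal.ofReal_mul (by positivity), hV,
      Measure.real, ENNReal.ofReal_toReal measure_closedBall_lt_top.ne]
    simp
  have htr := lintegral_closedBall_translate_le (isWeakGradient_weakGrad (toH1 u)) hf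
    (Lp.memLp _) ((N : ℝ) / n)
  have hgrad := X.eLpNorm_weakGrad_le u
  have hw := pow_le_pow_left₀ zero_le (X.eLpNorm_weight_le u) 2
  rw [eLpNorm_two_sq] at hw
  rw [← (ENNReal.pow_right_strictMono two_ne_zero).le_iff_le, eLpNorm_two_sq]
  calc ∫⁻ x, ‖toLp u x - cellAverage n (toLp u) x‖ₑ ^ 2
      ≤ ∫⁻ x, ((n : ℝ≥0∞) ^ N * (∫⁻ z in Metric.closedBall 0 ((N : ℝ) / n),
          ‖toLp u (x + z) - toLp u x‖ₑ ^ 2)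
        + ENNReal.ofReal (1 / n) ^ 2 * ‖‖x‖ * toLp u x‖ₑ ^ 2) :=
        lintegral_mono fun x => enorm_sub_cellAverage_sq_le hn hf x
    _ = (n : ℝ≥0∞) ^ N * (∫⁻ x, ∫⁻ z in Metric.closedBall 0 ((N : ℝ) / n),
          ‖toLp u (x + z) - toLp u x‖ₑ ^ 2)
        + ENNReal.ofReal (1 / n) ^ 2 * ∫⁻ x, ‖‖x‖ * toLp u x‖ₑ ^ 2 := by
        rw [lintegral_add_right', lintegral_const_mul' _ _ (by simp),
          lintegral_const_mul' _ _ (by simp)]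
        exact ((X.memLp_weight u).aestronglyMeasurable.enorm.pow_const 2).const_mul _
    _ ≤ (n : ℝ≥0∞) ^ N * (ENNReal.ofReal ((N / n) ^ N * V) *
          (ENNReal.ofReal ((N : ℝ) / n) * ‖u‖ₑ) ^ 2) + ENNReal.ofReal (1 / n) ^ 2 * ‖u‖ₑ ^ 2 := by
        rw [hball] at htr
        gcongr
        exact htr.trans (by gcongr)
    _ = ENNReal.ofReal ((K + 1) / n ^ 2) * ‖u‖ₑ ^ 2 := by
        rw [mul_pow, ← ENNReal.ofReal_natCast, ← ENNReal.ofReal_pow hn'.le,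
          ← ENNReal.ofReal_pow (by positivity), ← ENNReal.ofReal_pow (by positivity),
          ← mul_assoc, ← mul_assoc, ← ENNReal.ofReal_mul (by positivity),
          ← ENNReal.ofReal_mul (by positivity), ← add_mul, ← ENNReal.ofReal_add (by positivity)
          (by positivity)]
        congr 2
        rw [hK, div_pow]
        field_simp
    -- The squared error has constant `K + 1`, where `1` comes from the region outside the cubes;
    -- since `K + 1 ≤ (K + 1) ^ 2`, no square root is needed.
    _ ≤ _ := by
        rw [mul_pow, ← ENNReal.ofReal_pow (by positivity), div_pow]
        gcongr
        nlinarith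

/-- The embedding of `X` in `L²` is compact. -/
lemma X.isCompactOperator_two {ι : X N →L[ℝ] Lp ℝ 2 (volume : Measure (Space N))}
    (hι : ∀ u, ι u =ᵐ[volume] toLp u) : IsCompactOperator ι := by
  obtain ⟨M, hM⟩ := X.exists_sub_cellAverage_bound N
  choose A hA hAe using fun n : ℕ => exists_compact_cellAverage (N := N) n.succ_pos
  refine isCompactOperator_of_tendsto (l := atTop) (F := fun n => (A n).comp ι) ?_
    (Eventually.of_forall fun n => (hA n).comp_clm ι)
  have hι' : ∀ u, ι u = toLp u := fun u => Lp.ext (hι u)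
  -- The maximum with `0` supplies the nonnegative constant required of an operator norm bound, as
  -- the sign of `M` is not known here.
  have hlim : Tendsto (fun n : ℕ => max (M / ((n : ℝ) + 1)) 0) atTop (𝓝 0) := by
    have : Tendsto (fun n : ℕ => M / ((n : ℝ) + 1)) atTop (𝓝 0) := by
      simpa [div_eq_mul_inv] using tendsto_one_div_add_atTop_nhds_zero_nat.const_mul M
    simpa using this.max (tendsto_const_nhds (x := (0 : ℝ)))
  rw [tendsto_iff_norm_sub_tendsto_zero]
  refine squeeze_zero (fun _ => norm_nonneg _) (fun n => ?_) hlim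
  refine ContinuousLinearMap.opNorm_le_bound _ (le_max_right _ _) fun u => ?_
  rw [sub_apply, norm_sub_rev, ContinuousLinearMap.comp_apply, hι', Lp.norm_def]
  refine ENNReal.toReal_le_of_le_ofReal (by positivity) ?_
  rw [ENNReal.ofReal_mul (le_max_right _ _), ofReal_norm]
  refine (le_of_eq (eLpNorm_congr_ae ?_)).trans ((hM (n + 1) n.succ_pos u).trans ?_)
  · filter_upwards [Lp.coeFn_sub (toLp u) (A n (toLp u)), hAe n (toLp u)] with x h1 h2
    rw [h1, Pi.sub_apply, h2]
  · gcongr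
    push_cast
    exact le_max_left _ _

lemma X.norm_embedding {q : ℝ≥0∞} [Fact (1 ≤ q)]
    {ι : X N →L[ℝ] Lp ℝ q (volume : Measure (Space N))} (hι : ∀ u, ι u =ᵐ[volume] toLp u)
    (u : X N) : ‖ι u‖ = (eLpNorm (toLp u) q volume).toReal := by
  rw [Lp.norm_def, eLpNorm_congr_ae (hι u)]

end HarmonicOscillator

/-! ### The embedding theorem -/

open HarmonicOscillator in
theorem lemma4p2 (N : ℕ) [NeZero N] (hN : 3 ≤ N) (q : ENNReal) [Fact (1 ≤ q)] (hq : 2 ≤ q)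
    (hq' : q ≤ HarmonicOscillator.criticalExponent N) :
    ∃ ι : HarmonicOscillator.X N →L[ℝ]
        MeasureTheory.Lp ℝ q
          (MeasureTheory.volume : MeasureTheory.Measure (HarmonicOscillator.Space N)),
      (∀ u : HarmonicOscillator.X N,
        ι u =ᵐ[MeasureTheory.volume] HarmonicOscillator.X.toLp u) ∧
      (q < HarmonicOscillator.criticalExponent N → IsCompactOperator ι) := by
  obtain ⟨C, hC⟩ := X.exists_bound hN hq hq'
  obtain ⟨C₂, hC₂⟩ := X.exists_two_bound hN
  obtain ⟨ι, hι⟩ := X.exists_embedding hC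
  obtain ⟨ι₂, hι₂⟩ := X.exists_embedding hC₂
  refine ⟨ι, hι, fun hlt => ?_⟩
  obtain ⟨D, θ, -, h1, h0, H⟩ := X.exists_interpolation hN hq hq'
  -- Subcriticality gives `θ > 0`, so compactness of the `L²` embedding `ι₂` passes to `ι`.
  refine isCompactOperator_of_interpolation D.coe_nonneg (h0 hlt) h1 (fun u => ?_)
    (X.isCompactOperator_two hι₂)
  have hfin : D * eLpNorm (X.toLp u) 2 volume ^ θ * ‖u‖ₑ ^ (1 - θ) ≠ ⊤ :=
    ENNReal.mul_ne_top (ENNReal.mul_ne_top ENNReal.coe_ne_top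
      (ENNReal.rpow_ne_top_of_nonneg (h0 hlt).le (Lp.memLp _).eLpNorm_ne_top))
      (ENNReal.rpow_ne_top_of_nonneg (sub_nonneg.2 h1) (by simp))
  rw [X.norm_embedding hι, X.norm_embedding hι₂]
  refine (ENNReal.toReal_mono hfin (H u)).trans_eq ?_
  rw [ENNReal.toReal_mul, ENNReal.toReal_mul, ← ENNReal.toReal_rpow, ← ENNReal.toReal_rpow,
    toReal_enorm, ENNReal.coe_toReal]
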